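/- Let $\mathcal H$ be a real Hilbert space. For $f:\mathcal H\to\mathbb R\cup\{\pm\infty\}$ let $\partial f(x)=\{u\in\mathcal H : f(y)\ge f(x)+\langle u,y-x\rangle \text{ for all } y\in\mathcal H\}$. For $0\le\mu<\infty$ and $0<L\le\infty$ let $\mathcal F_{\mu,L}$ be the set of convex, closed (lower semicontinuous) and proper functions $f$ on $\mathcal H$ that are $\mu$-strongly convex (no further condition if $\mu=0$) and, if $L<\infty$, $L$-smooth, i.e. finite everywhere and differentiable with $L$-Lipschitz gradient. For multi-valued operators $A,B,C$ on $\mathcal H$ and $\alpha,\lambda>0$ put $J_{\alpha A}=(I+\alpha A)^{-1}$ and \[ T_{A,B,C,\alpha,\lambda}=I-\lambda J_{\alpha B}+\lambda J_{\alpha A}\bigl(2J_{\alpha B}-I-\alpha C J_{\alpha B}\bigr). \] Let $f\in\mathcal F_{\mu_f,L_f}$, $g\in\mathcal F_{\mu_g,L_g}$, $h\in\mathcal F_{\mu_h,L_h}$, where $0\le\mu_f<L_f\le\infty$, $0\le\mu_g<L_g\le\infty$ and $0\le\mu_h<L_h<\infty$. Let $\alpha>0$ and $0<\lambda<2-\frac{\alpha(\mu_h+L_h)}{2}$.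 Put $\theta=\frac{2}{4-\alpha(\mu_h+L_h)}$, \[ \nu_f=\min\Bigl\{\tfrac{2\mu_f+\mu_h}{(1+\alpha\mu_f)^2},\tfrac{2L_f+\mu_h}{(1+\alpha L_f)^2}\Bigr\},\qquad \nu_g=\min\Bigl\{\tfrac{2\mu_g+\mu_h}{(1+\alpha\mu_g)^2},\tfrac{2L_g+\mu_h}{(1+\alpha L_g)^2}\Bigr\}, \] where the second fraction is read as $0$ if $L_f=\infty$, respectively $L_g=\infty$, and \[ \kappa=1-\lambda\theta+\lambda\sqrt{(\theta-\alpha\nu_f)(\theta-\alpha\nu_g)}. \] Then $\theta-\alpha\nu_f\ge 0$, $\theta-\alpha\nu_g\ge 0$ and $0\le\kappa\le 1$. The operator $T=T_{\partial f,\partial g,\nabla h,\alpha,\lambda}$ (where $\nabla h=\partial h$) is single-valued and defined on all of $\mathcal H$, and it is $\kappa$-contractive: \[ \|Tx-Ty\|\le\kappa\,\|x-y\|\qquad\text{for all }x,y\in\mathcal H. \] In particular, $T$ is also $\rho$-contractive (that is, $\|Tx-Ty\|\le\rho\|x-y\|$ for all $x,y$) for the $\rho\ge 0$ with $\rho^2=\kappa$.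 -/

import Mathlib

open scoped NNReal ENNReal Pointwise InnerProductSpace

namespace DYS

section Operators

variable {H : Type*} [NormedAddCommGroup H] [InnerProductSpace ℝ H]

/-- Multi-valued operators on `H` are maps `H → Set H`; their sums, differences and scalar multiples
are the pointwise ones, `(A + B) x = {u + v | u ∈ A x, v ∈ B x}` and `(c • A) x = {c • u | u ∈ A x}`.
This is the identity operator. -/
def idOp : H → Set H := fun x => {x}

/-- The inverse operator: `x ∈ A⁻¹ u` iff `u ∈ A x`. -/
def invOp (A : H → Set H) : H → Set H := fun u => {x | u ∈ A x}

/-- The composition `A B`: first `B`, then `A`. -/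
def compOp (A B : H → Set H) : H → Set H := fun x => {s | ∃ u ∈ B x, s ∈ A u}

/-- The domain of an operator. -/
def domOp (A : H → Set H) : Set H := {x | (A x).Nonempty}

/-- The resolvent `(I + α A)⁻¹`. -/
def resolventOp (α : ℝ) (A : H → Set H) : H → Set H := invOp (idOp + α • A)

/-- The Davis--Yin splitting operator `I - λ J_B + λ J_A (2 J_B - I - α C J_B)`, where `J_A` and `J_B`
are the resolvents of `A` and `B` with step size `α`. -/
def dysOp (A B C : H → Set H) (α lam : ℝ) : H → Set H :=
  idOp - lam • resolventOp α B
    + lam • compOp (resolventOp α A)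
        ((2 : ℝ) • resolventOp α B - idOp - α • compOp C (resolventOp α B))

/-- An operator is `ρ`-Lipschitz (`ρ`-contractive) if `‖u - v‖ ≤ ρ ‖x - y‖` for all `u ∈ A x` and
`v ∈ A y`. Taking `x = y`, such an operator is single-valued on its domain. -/
def IsContractiveOp (ρ : ℝ) (A : H → Set H) : Prop :=
  ∀ ⦃x y u v : H⦄, u ∈ A x → v ∈ A y → ‖u - v‖ ≤ ρ * ‖x - y‖

/-- The subdifferential of an extended real-valued function. -/
def subdiff (f : H → EReal) : H → Set H :=
  fun x => {u | ∀ y, f x + ((⟪u, y - x⟫_ℝ : ℝ) : EReal) ≤ f y}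

/-- Strong convexity with modulus `μ` of a function with values in `(-∞, ∞]`;
modulus `0` is convexity. -/
def IsStronglyConvex (μ : ℝ≥0) (f : H → EReal) : Prop :=
  ∀ (x y : H) (a b : ℝ), 0 < a → 0 < b → a + b = 1 →
    f (a • x + b • y) + (((μ : ℝ) / 2 * (a * b) * ‖x - y‖ ^ 2 : ℝ) : EReal)
      ≤ (a : EReal) * f x + (b : EReal) * f y

/-- Convex, closed and proper functions. -/
structure IsCCP (f : H → EReal) : Prop where
  ne_bot : ∀ x, f x ≠ ⊥
  exists_ne_top : ∃ x, f x ≠ ⊤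
  convex : IsStronglyConvex 0 f
  closed : LowerSemicontinuous f

/-- `L`-smoothness: finite everywhere and differentiable with `L`-Lipschitz gradient. -/
def IsSmooth [CompleteSpace H] (L : ℝ≥0) (f : H → EReal) : Prop :=
  ∃ φ : H → ℝ, (∀ x, f x = (φ x : EReal)) ∧ Differentiable ℝ φ ∧ LipschitzWith L (gradient φ)

/-- The class `ℱ_{μ,L}` of convex, closed and proper functions that are `μ`-strongly convex (no further
condition if `μ = 0`) and `L`-smooth (no condition if `L = ∞`). -/
structure FClass [CompleteSpace H] (μ : ℝ≥0) (L : ℝ≥0∞) (f : H → EReal) : Prop where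
  ccp : IsCCP f
  stronglyConvex : IsStronglyConvex μ f
  smooth : ∀ l : ℝ≥0, L = (l : ℝ≥0∞) → IsSmooth l f

end Operators

/-- The expression `(2 t + μ_h) / (1 + α t)²`, with value `0` at `t = ∞`. -/
noncomputable def endpointTerm (α : ℝ) (μh : ℝ≥0) (t : ℝ≥0∞) : ℝ :=
  if t = ∞ then 0 else (2 * t.toReal + (μh : ℝ)) / (1 + α * t.toReal) ^ 2

/-- The minimum of `(2 t + μ_h) / (1 + α t)²` over the two endpoints `t = μ` and `t = L`. -/
noncomputable def nu (α : ℝ) (μh μ : ℝ≥0) (L : ℝ≥0∞) : ℝ :=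
  min (endpointTerm α μh (μ : ℝ≥0∞)) (endpointTerm α μh L)

end DYS

/-!
Only differences of the quantities attached to two inputs matter. Write `d` for the difference of
the inputs, `b` and `a` for those of the inner and the outer resolvent, and `c` for that of the
gradients of `h`; then `a` is the resolvent difference for `z = 2 b - d - α c`, the difference of
the outputs is `(1 - λ θ) d + λ e` with `e = θ d - b + a`, and it suffices to show
`‖e‖ ≤ √((θ - α ν_f) (θ - α ν_g)) ‖d‖` (`DYS.norm_core_le`).

By the Baillon-Haddad inequality (`DYS.FClass.inSector_subdiff`) each of the three pairs `(d, b)`,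
`(z, a)`, `(b, c)` satisfies a sector inequality: the second entry lies in the ball whose diameter
joins two multiples of the first. The key step is that a single pair in a sector is interpolated by
a symmetric linear map `U` that satisfies the sector inequality at every vector, namely a combination
of the identity and a reflection (`DYS.InSector.exists_isSymmetric`). With `a = U z`, symmetry turns
`‖e‖²` into the bilinear expression
`θ ⟪e - θ⁻¹ U e, d - θ⁻¹ b⟫ - α ⟪U e, c - (μ_h + L_h) / 2 b⟫`.
With `δ = α (L_h - μ_h) / 2`, the sector inequality of `(b, c)` bounds the second factor of the last
term by `δ / α ‖b‖`, so Cauchy-Schwarz bounds the whole by the geometric mean of the values at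
`(e, U e)` and `(d, b)` of
`F (x, y) = θ ‖x - θ⁻¹ y‖² + δ ‖y‖² = θ ‖x‖² - 2 ⟪x, y⟫ + (2 - α μ_h) ‖y‖²`.
On a sector, `F (x, y) / ‖x‖²` is largest at the endpoints `y = u x`
(`DYS.InSector.quadratic_le`), and for the resolvent sectors these endpoint values are at most
`θ - α ν_f` and `θ - α ν_g`.

That the operator is defined everywhere amounts to the existence of proximal points
(`DYS.IsCCP.exists_prox`), obtained by minimizing directly: lower semicontinuity at one point and
convexity give a lower bound that is linear in the distance, and minimizing sequences are Cauchy.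
-/

namespace DYS

open Filter Topology

/-! ### Sector inequalities and symmetric interpolation -/

section Sector

variable {H : Type*} [NormedAddCommGroup H] [InnerProductSpace ℝ H]

/-- The sector `p ≤ U ≤ q`, read on the single pair `(z, a)` with `a = U z`: this is membership
of `a` in the closed ball with diameter `[p z, q z]`. -/
def InSector (p q : ℝ) (z a : H) : Prop := 0 ≤ ⟪a - p • z, q • z - a⟫_ℝ

theorem inner_sector_eq (p q : ℝ) (z a : H) :
    ⟪a - p • z, q • z - a⟫_ℝ = (p + q) * ⟪z, a⟫_ℝ - p * q * ‖z‖ ^ 2 - ‖a‖ ^ 2 := by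
  simp only [inner_sub_left, inner_sub_right, real_inner_smul_left, real_inner_smul_right,
    real_inner_self_eq_norm_sq, real_inner_comm z a]
  ring

theorem inner_sector_eq_ball (p q : ℝ) (z a : H) :
    ⟪a - p • z, q • z - a⟫_ℝ
      = ((q - p) / 2) ^ 2 * ‖z‖ ^ 2 - ‖a - ((p + q) / 2) • z‖ ^ 2 := by
  rw [inner_sector_eq, norm_sub_sq_real, norm_smul, real_inner_smul_right, mul_pow,
    Real.norm_eq_abs, sq_abs, real_inner_comm z a]
  ring

/-- A pair satisfying a sector inequality is interpolated by a *symmetric linear* map satisfying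
the same sector inequality at every vector: a multiple of the identity plus a multiple of
a reflection. -/
theorem InSector.exists_isSymmetric {p q : ℝ} {z a : H} (h : InSector p q z a) :
    ∃ U : H →ₗ[ℝ] H, U z = a ∧ U.IsSymmetric ∧ ∀ x, InSector p q x (U x) := by
  set k := (p + q) / 2 with hk
  set y := a - k • z with hy
  have hball : ‖y‖ ^ 2 ≤ ((q - p) / 2) ^ 2 * ‖z‖ ^ 2 := by
    have := inner_sector_eq_ball p q z a
    unfold InSector at h
    linarith
  -- for `z = 0` the quotient is the junk value `0`, which is the right one
  set s := ‖y‖ / ‖z‖ with hs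
  have hsz : s * ‖z‖ = ‖y‖ := by
    rcases eq_or_ne ‖z‖ 0 with h0 | h0
    · have : ‖y‖ ^ 2 ≤ 0 := by simpa [h0] using hball
      have : ‖y‖ = 0 := by nlinarith [norm_nonneg y]
      simp [h0, this]
    · rw [hs]; field_simp
  have hs0 : 0 ≤ s := by positivity
  have hs2 : s ^ 2 ≤ ((q - p) / 2) ^ 2 := by
    rcases eq_or_ne ‖z‖ 0 with h0 | h0
    · have : s = 0 := by rw [hs, h0, div_zero]
      rw [this, zero_pow two_ne_zero]; positivity
    · have hz : 0 < ‖z‖ ^ 2 := pow_pos (lt_of_le_of_ne (norm_nonneg z) h0.symm) 2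
      refine le_of_mul_le_mul_right ?_ hz
      rw [← mul_pow, hsz]; exact hball
  let R := Submodule.reflection (ℝ ∙ (s • z - y))ᗮ
  have hR : R (s • z) = y := by
    apply Submodule.reflection_sub
    rw [norm_smul, Real.norm_of_nonneg hs0, hsz]
  have hRsym : ∀ x w, ⟪R x, w⟫_ℝ = ⟪x, R w⟫_ℝ := by
    intro x w
    rw [← R.inner_map_map x (R w)]
    simp [R, Submodule.reflection_reflection]
  refine ⟨k • LinearMap.id + s • R.toLinearEquiv.toLinearMap, ?_, ?_, ?_⟩
  · have : s • R z = y := by rw [← map_smul, hR]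
    simp [this, hy]
  · intro x w
    simp [inner_add_left, inner_add_right, real_inner_smul_left, real_inner_smul_right, hRsym]
  · intro x
    unfold InSector
    rw [inner_sector_eq_ball]
    have : (k • (LinearMap.id : H →ₗ[ℝ] H) + s • R.toLinearEquiv.toLinearMap) x - ((p + q) / 2) • x
        = s • R x := by
      simp [k]
    rw [this, norm_smul, Real.norm_of_nonneg hs0, R.norm_map, mul_pow]
    nlinarith [sq_nonneg ‖x‖]

theorem InSector.eq_zero {p q : ℝ} {a : H} (h : InSector p q 0 a) : a = 0 := by
  unfold InSector at h
  rw [inner_sector_eq] at h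
  have : ‖a‖ ^ 2 ≤ 0 := by simpa using h
  simpa using this

/-- On a sector, a quadratic form `γ ‖a‖² - 2 ⟪z, a⟫` is largest at the endpoints `a = p z`
and `a = q z`. -/
theorem InSector.quadratic_le {p q γ M : ℝ} {z a : H} (h : InSector p q z a) (hγ : 0 ≤ γ)
    (hpq : p ≤ q) (hp : γ * p ^ 2 - 2 * p ≤ M) (hq : γ * q ^ 2 - 2 * q ≤ M) :
    γ * ‖a‖ ^ 2 - 2 * ⟪z, a⟫_ℝ ≤ M * ‖z‖ ^ 2 := by
  unfold InSector at h
  rw [inner_sector_eq] at h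
  have hcs : ⟪z, a⟫_ℝ ^ 2 ≤ ‖z‖ ^ 2 * ‖a‖ ^ 2 := by
    have := abs_real_inner_le_norm z a
    rw [← mul_pow, ← sq_abs]
    gcongr
  set t := ⟪z, a⟫_ℝ
  rcases eq_or_lt_of_le (norm_nonneg z) with h0 | h0
  · have h0 : z = 0 := by simpa using h0.symm
    have ht : t = 0 := by simp [t, h0]
    have ha : a = 0 := by
      simp only [ht, h0, norm_zero] at h
      have : ‖a‖ ^ 2 ≤ 0 := by linarith
      simpa using this
    simp [ht, ha, h0]
  have hn : 0 < ‖z‖ ^ 2 := by positivity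
  set n := ‖z‖ ^ 2
  -- Cauchy-Schwarz confines `t = ⟪z, a⟫` to the interval `[p ‖z‖², q ‖z‖²]`
  have hprod : 0 ≤ (t - p * n) * (q * n - t) := by nlinarith
  have hb : t - p * n ≥ 0 ∧ q * n - t ≥ 0 := by
    have : p * n ≤ q * n := by gcongr
    constructor
    · by_contra! hc
      nlinarith
    · by_contra! hc
      nlinarith
  have h1 : γ * ‖a‖ ^ 2 ≤ γ * ((p + q) * t - p * q * n) := by gcongr; linarith
  rcases eq_or_lt_of_le hpq with rfl | hlt
  · have ht : t = p * n := by linarith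
    have := mul_le_mul_of_nonneg_right hp hn.le
    rw [ht] at h1 ⊢
    linarith
  -- the bound is affine in `t`, hence it suffices to have it at both ends of the interval
  have key : (q - p) * (γ * ((p + q) * t - p * q * n) - 2 * t)
      ≤ (q - p) * (M * n) := by
    have e1 : (q * n - t) * (γ * p ^ 2 - 2 * p) ≤ (q * n - t) * M :=
      mul_le_mul_of_nonneg_left hp hb.2
    have e2 : (t - p * n) * (γ * q ^ 2 - 2 * q) ≤ (t - p * n) * M :=
      mul_le_mul_of_nonneg_left hq hb.1
    nlinarith
  have := le_of_mul_le_mul_left key (by linarith)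
  linarith

/-! ### The contraction estimate for differences -/

/-- Cauchy-Schwarz for a bilinear form in `(x, a)` and `(d, b)` that is dominated by the quadratic
form `θ ‖x‖² + δ ‖a‖²`; the vector `c` stands for an image of `b` of norm at most `δ / α ‖b‖`. -/
theorem bilinear_le_sqrt {θ δ α : ℝ} (hθ : 0 ≤ θ) (hδ : 0 ≤ δ) (hα : 0 ≤ α) {x a d b c : H}
    (hc : α * ‖c‖ ≤ δ * ‖b‖) {P Q : ℝ}
    (hP : θ * ‖x‖ ^ 2 + δ * ‖a‖ ^ 2 ≤ P) (hQ : θ * ‖d‖ ^ 2 + δ * ‖b‖ ^ 2 ≤ Q) :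
    θ * ⟪x, d⟫_ℝ - α * ⟪a, c⟫_ℝ ≤ √(P * Q) := by
  have h1 : θ * ⟪x, d⟫_ℝ ≤ θ * (‖x‖ * ‖d‖) :=
    mul_le_mul_of_nonneg_left (real_inner_le_norm x d) hθ
  have h2 : -(α * ⟪a, c⟫_ℝ) ≤ δ * (‖a‖ * ‖b‖) := by
    have h3 := (abs_le.1 (abs_real_inner_le_norm a c)).1
    have h4 : ‖a‖ * (α * ‖c‖) ≤ ‖a‖ * (δ * ‖b‖) := by gcongr
    nlinarith
  refine le_trans (by linarith : _ ≤ θ * (‖x‖ * ‖d‖) + δ * (‖a‖ * ‖b‖)) ?_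
  apply Real.le_sqrt_of_sq_le
  have hP0 : 0 ≤ θ * ‖x‖ ^ 2 + δ * ‖a‖ ^ 2 := by positivity
  refine le_trans ?_ (mul_le_mul hP hQ (by positivity) (hP0.trans hP))
  have : 0 ≤ θ * δ * (‖x‖ * ‖b‖ - ‖a‖ * ‖d‖) ^ 2 := by positivity
  nlinarith

/-- The nonexpansive part `θ d - b + a` of the splitting step, where `d` is the difference of the
inputs, `b` and `a` those of the two resolvents, and `c` that of the forward steps. -/
theorem norm_core_le {θ α m M P Q p q p' q' : ℝ} (hα : 0 < α) (hmM : m ≤ M)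
    (hs : α * (m + M) < 4) (hθ : θ = 2 / (4 - α * (m + M)))
    (hpq : p ≤ q) (hpq' : p' ≤ q')
    (hp : θ - 2 * p + (2 - α * m) * p ^ 2 ≤ P) (hq : θ - 2 * q + (2 - α * m) * q ^ 2 ≤ P)
    (hp' : θ - 2 * p' + (2 - α * m) * p' ^ 2 ≤ Q) (hq' : θ - 2 * q' + (2 - α * m) * q' ^ 2 ≤ Q)
    {d b c a : H} (hb : InSector p' q' d b) (hc : InSector m M b c)
    (ha : InSector p q ((2 : ℝ) • b - d - α • c) a) :
    ‖θ • d - b + a‖ ≤ √(P * Q) * ‖d‖ := by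
  obtain ⟨U, rfl, hsym, hU⟩ := ha.exists_isSymmetric
  set e := θ • d - b + U ((2 : ℝ) • b - d - α • c) with he
  have hden : 0 < 4 - α * (m + M) := by linarith
  have hθ0 : 0 < θ := by rw [hθ]; positivity
  have hθinv : θ * (2 - α * (m + M) / 2) = 1 := by
    rw [hθ]; field_simp; ring
  set δ := α * (M - m) / 2 with hδ
  have hδ0 : 0 ≤ δ := by
    have : 0 ≤ M - m := by linarith
    positivity
  have hγ : 0 ≤ 2 - α * m := by nlinarith
  -- the quadratic form shared by both resolvents
  have form : ∀ (z w : H) (u v N : ℝ), u ≤ v → θ - 2 * u + (2 - α * m) * u ^ 2 ≤ N →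
      θ - 2 * v + (2 - α * m) * v ^ 2 ≤ N → InSector u v z w →
      θ * ‖z - (2 - α * (m + M) / 2) • w‖ ^ 2 + δ * ‖w‖ ^ 2 ≤ N * ‖z‖ ^ 2 := by
    intro z w u v N huv h1 h2 h
    have := h.quadratic_le hγ huv (M := N - θ) (by linarith) (by linarith)
    rw [norm_sub_sq_real, norm_smul, mul_pow, Real.norm_eq_abs, sq_abs, real_inner_smul_right]
    have e1 : θ * (‖z‖ ^ 2 - 2 * ((2 - α * (m + M) / 2) * ⟪z, w⟫_ℝ)
        + (2 - α * (m + M) / 2) ^ 2 * ‖w‖ ^ 2)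
        = θ * ‖z‖ ^ 2 - 2 * (θ * (2 - α * (m + M) / 2)) * ⟪z, w⟫_ℝ
          + (θ * (2 - α * (m + M) / 2)) * (2 - α * (m + M) / 2) * ‖w‖ ^ 2 := by ring
    rw [e1, hθinv, hδ]
    linarith
  have hF := form e (U e) p q P hpq hp hq (hU e)
  have hG := form d b p' q' Q hpq' hp' hq' hb
  have hcc : α * ‖c - ((m + M) / 2) • b‖ ≤ δ * ‖b‖ := by
    unfold InSector at hc
    rw [inner_sector_eq_ball] at hc
    have : ‖c - ((m + M) / 2) • b‖ ≤ (M - m) / 2 * ‖b‖ := by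
      apply le_of_sq_le_sq _ (mul_nonneg (by linarith) (norm_nonneg _))
      rw [mul_pow]; linarith
    calc _ ≤ α * ((M - m) / 2 * ‖b‖) := by gcongr
      _ = _ := by rw [hδ]; ring
  have key := bilinear_le_sqrt hθ0.le hδ0 hα.le hcc hF hG
  -- testing with `e` itself and moving `U` to the other side recovers `‖e‖²`
  have hee : θ * ⟪e - (2 - α * (m + M) / 2) • U e, d - (2 - α * (m + M) / 2) • b⟫_ℝ
      - α * ⟪U e, c - ((m + M) / 2) • b⟫_ℝ = ‖e‖ ^ 2 := by
    have h1 : ‖e‖ ^ 2 = ⟪e, θ • d - b⟫_ℝ + ⟪U e, (2 : ℝ) • b - d - α • c⟫_ℝ := by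
      rw [hsym e, ← inner_add_right, ← he, real_inner_self_eq_norm_sq]
    rw [h1]
    simp only [inner_sub_left, inner_sub_right, real_inner_smul_left, real_inner_smul_right]
    linear_combination (-⟪e, b⟫_ℝ - ⟪U e, d⟫_ℝ
      + (2 - α * (m + M) / 2) * ⟪U e, b⟫_ℝ) * hθinv
  rw [hee] at key
  have e2 : P * ‖e‖ ^ 2 * (Q * ‖d‖ ^ 2) = P * Q * (‖e‖ * ‖d‖) ^ 2 := by ring
  rw [e2, Real.sqrt_mul' _ (by positivity), Real.sqrt_sq (by positivity)] at key
  rcases eq_or_lt_of_le (norm_nonneg e) with h0 | h0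
  · rw [← h0]; positivity
  · refine le_of_mul_le_mul_left ?_ h0
    nlinarith

end Sector

/-! ### Extended-valued convex functions -/

section Convex

variable {H : Type*} [NormedAddCommGroup H] [InnerProductSpace ℝ H]

theorem le_of_forall_le_add_mul {A B C : ℝ} (h : ∀ t : ℝ, 0 < t → t < 1 → A ≤ B + t * C) :
    A ≤ B := by
  have ht : Tendsto (fun t : ℝ => B + t * C) (𝓝[>] 0) (𝓝 (B + 0 * C)) :=
    ((continuous_const.add (continuous_id.mul continuous_const)).tendsto 0).mono_left
      nhdsWithin_le_nhds
  have : A ≤ B + 0 * C := by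
    refine ge_of_tendsto ht ?_
    filter_upwards [Ioo_mem_nhdsGT (zero_lt_one (α := ℝ))] with t ht
    exact h t ht.1 ht.2
  simpa using this

theorem IsCCP.exists_coe {f : H → EReal} (hf : IsCCP f) {x : H} (hx : f x ≠ ⊤) :
    ∃ r : ℝ, f x = r := ⟨(f x).toReal, (EReal.coe_toReal hx (hf.ne_bot x)).symm⟩

/-- Strong convexity at points of the domain, in terms of real numbers. -/
theorem IsStronglyConvex.exists_coe_le {f : H → EReal} {μ : ℝ≥0} (hc : IsStronglyConvex μ f)
    (hf : IsCCP f) {x y : H} {r s t : ℝ} (hx : f x = r) (hy : f y = s) (h0 : 0 < t)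
    (h1 : t < 1) :
    ∃ w : ℝ, f (x + t • (y - x)) = w ∧
      w + μ / 2 * ((1 - t) * t) * ‖x - y‖ ^ 2 ≤ (1 - t) * r + t * s := by
  have h := hc x y (1 - t) t (by linarith) h0 (by ring)
  have e : (1 - t) • x + t • y = x + t • (y - x) := by module
  rw [e, hx, hy] at h
  have hne : f (x + t • (y - x)) ≠ ⊤ := by
    intro htop
    rw [htop, EReal.top_add_coe, top_le_iff] at h
    exact EReal.coe_ne_top ((1 - t) * r + t * s) (by exact_mod_cast h)
  obtain ⟨w, hw⟩ := hf.exists_coe hne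
  refine ⟨w, hw, ?_⟩
  rw [hw] at h
  exact_mod_cast h

theorem IsCCP.ne_top_of_mem_subdiff {f : H → EReal} (hf : IsCCP f) {x u : H}
    (hu : u ∈ subdiff f x) : f x ≠ ⊤ := by
  intro h
  obtain ⟨y, hy⟩ := hf.exists_ne_top
  have := hu y
  rw [h, EReal.top_add_coe, top_le_iff] at this
  exact hy this

/-- Subgradients of a strongly convex function satisfy a subgradient inequality with
a quadratic gain. -/
theorem IsStronglyConvex.subgradient_le {f : H → EReal} {μ : ℝ≥0} (hc : IsStronglyConvex μ f)
    (hf : IsCCP f) {x y u : H} (hu : u ∈ subdiff f x) {r s : ℝ} (hx : f x = r) (hy : f y = s) :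
    r + ⟪u, y - x⟫_ℝ + μ / 2 * ‖x - y‖ ^ 2 ≤ s := by
  apply le_of_forall_le_add_mul (C := μ / 2 * ‖x - y‖ ^ 2)
  intro t h0 h1
  obtain ⟨w, hw, hle⟩ := hc.exists_coe_le hf hx hy h0 h1
  have h := hu (x + t • (y - x))
  rw [hx, hw, add_sub_cancel_left, real_inner_smul_right] at h
  have h : r + t * ⟪u, y - x⟫_ℝ ≤ w := by exact_mod_cast h
  refine le_of_mul_le_mul_left ?_ h0
  nlinarith

/-- Strong monotonicity of the subdifferential. -/
theorem IsStronglyConvex.inner_subgradients_ge {f : H → EReal} {μ : ℝ≥0}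
    (hc : IsStronglyConvex μ f) (hf : IsCCP f) {x y u v : H} (hu : u ∈ subdiff f x)
    (hv : v ∈ subdiff f y) : μ * ‖x - y‖ ^ 2 ≤ ⟪u - v, x - y⟫_ℝ := by
  obtain ⟨r, hr⟩ := hf.exists_coe (hf.ne_top_of_mem_subdiff hu)
  obtain ⟨s, hs⟩ := hf.exists_coe (hf.ne_top_of_mem_subdiff hv)
  have h1 := hc.subgradient_le hf hu hr hs
  have h2 := hc.subgradient_le hf hv hs hr
  rw [norm_sub_rev y x] at h2
  simp only [inner_sub_left, inner_sub_right] at *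
  linarith

/-! ### Existence of proximal points -/

/-- A closed proper convex function decreases at most linearly: it is bounded below near a point of
its domain by lower semicontinuity, and convexity propagates the bound. -/
theorem IsCCP.exists_linear_minorant {f : H → EReal} (hf : IsCCP f) {x₀ : H} {r₀ : ℝ}
    (h₀ : f x₀ = r₀) : ∃ c k : ℝ, 0 ≤ k ∧ ∀ y s, f y = (s : ℝ) → c - k * ‖y - x₀‖ ≤ s := by
  have hlsc : ∀ᶠ z in 𝓝 x₀, ((r₀ - 1 : ℝ) : EReal) < f z :=
    hf.closed x₀ ((r₀ - 1 : ℝ) : EReal) (show _ < f x₀ by rw [h₀]; exact_mod_cast sub_one_lt r₀)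
  obtain ⟨ε, hε, hball⟩ := Metric.eventually_nhds_iff.1 hlsc
  refine ⟨r₀ - 1, 2 / ε, by positivity, fun y s hy => ?_⟩
  have hnn := norm_nonneg (y - x₀)
  rcases lt_or_ge ‖y - x₀‖ ε with hlt | hge
  · have := hball (by rwa [dist_eq_norm])
    rw [hy] at this
    have h3 : r₀ - 1 < s := by exact_mod_cast this
    have : 0 ≤ 2 / ε * ‖y - x₀‖ := by positivity
    linarith
  · have hpos : 0 < ‖y - x₀‖ := by linarith
    -- the point of the segment from `x₀` to `y` at distance `ε / 2` from `x₀`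
    set t := ε / 2 / ‖y - x₀‖ with ht
    have htn : t * ‖y - x₀‖ = ε / 2 := by rw [ht]; field_simp
    have ht0 : 0 < t := by positivity
    have ht1 : t < 1 := by rw [ht, div_lt_one hpos]; linarith
    obtain ⟨w, hw, hle⟩ := hf.convex.exists_coe_le hf h₀ hy ht0 ht1
    have := @hball (x₀ + t • (y - x₀)) (by
      rw [dist_eq_norm, add_sub_cancel_left, norm_smul, Real.norm_of_nonneg ht0.le, htn]
      linarith)
    rw [hw] at this
    have h3 : r₀ - 1 < w := by exact_mod_cast this
    simp only [NNReal.coe_zero, zero_div, zero_mul, add_zero] at hle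
    have h4 : -1 ≤ t * (s - r₀) := by linarith
    have h5 : t * (2 / ε * ‖y - x₀‖) = 1 := by
      rw [show t * (2 / ε * ‖y - x₀‖) = 2 / ε * (t * ‖y - x₀‖) by ring, htn]
      field_simp
    have h6 : -(2 / ε * ‖y - x₀‖) ≤ s - r₀ := by
      refine le_of_mul_le_mul_left ?_ ht0
      linarith
    linarith

/-- The proximal objective of a closed proper convex function attains its minimum: by uniform
convexity of the squared norm, minimizing sequences are Cauchy. -/
theorem IsCCP.exists_prox [CompleteSpace H] {f : H → EReal} (hf : IsCCP f) {k : ℝ} (hk : 0 < k)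
    (x : H) : ∃ (p : H) (r : ℝ), f p = r ∧
      ∀ y s, f y = (s : ℝ) → r + k * ‖p - x‖ ^ 2 ≤ s + k * ‖y - x‖ ^ 2 := by
  obtain ⟨x₀, hx₀⟩ := hf.exists_ne_top
  obtain ⟨r₀, h₀⟩ := hf.exists_coe hx₀
  obtain ⟨c, K, hK, hmin⟩ := hf.exists_linear_minorant h₀
  let S : Set ℝ := {v | ∃ y s, f y = (s : ℝ) ∧ v = s + k * ‖y - x‖ ^ 2}
  have hSne : S.Nonempty := ⟨_, x₀, r₀, h₀, rfl⟩
  have hSbdd : BddBelow S := by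
    refine ⟨c - K * ‖x - x₀‖ - K ^ 2 / (4 * k), ?_⟩
    rintro v ⟨y, s, hy, rfl⟩
    have h1 := hmin y s hy
    have h2 : ‖y - x₀‖ ≤ ‖y - x‖ + ‖x - x₀‖ := norm_sub_le_norm_sub_add_norm_sub y x x₀
    have h3 : 0 ≤ k * (‖y - x‖ - K / (2 * k)) ^ 2 := by positivity
    have h4 : k * (‖y - x‖ - K / (2 * k)) ^ 2
        = k * ‖y - x‖ ^ 2 - K * ‖y - x‖ + K ^ 2 / (4 * k) := by field_simp; ring
    have h5 : K * ‖y - x₀‖ ≤ K * (‖y - x‖ + ‖x - x₀‖) := by gcongr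
    linarith
  set m := sInf S
  have hm : ∀ y s, f y = (s : ℝ) → m ≤ s + k * ‖y - x‖ ^ 2 :=
    fun y s hy => csInf_le hSbdd ⟨y, s, hy, rfl⟩
  have hseq : ∀ n : ℕ, ∃ y s, f y = (s : ℝ) ∧ s + k * ‖y - x‖ ^ 2 < m + 1 / ((n : ℝ) + 1) := by
    intro n
    obtain ⟨v, ⟨y, s, hy, rfl⟩, hv⟩ := exists_lt_of_csInf_lt hSne
      (lt_add_of_pos_right m (Nat.one_div_pos_of_nat (α := ℝ) (n := n)))
    exact ⟨y, s, hy, hv⟩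
  choose y s hy hs using hseq
  have hdist : ∀ i j, k / 4 * ‖y i - y j‖ ^ 2 ≤ 1 / 2 * (1 / ((i : ℝ) + 1) + 1 / ((j : ℝ) + 1)) := by
    intro i j
    obtain ⟨w, hw, hle⟩ := hf.convex.exists_coe_le hf (hy i) (hy j) (t := 1 / 2)
      (by norm_num) (by norm_num)
    have h1 := hm _ _ hw
    simp only [NNReal.coe_zero, zero_div, zero_mul, add_zero] at hle
    have h2 : ‖y i + (1 / 2 : ℝ) • (y j - y i) - x‖ ^ 2
        = 1 / 2 * ‖y i - x‖ ^ 2 + 1 / 2 * ‖y j - x‖ ^ 2 - 1 / 4 * ‖y i - y j‖ ^ 2 := by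
      have e1 : y i + (1 / 2 : ℝ) • (y j - y i) - x
          = (1 / 2 : ℝ) • ((y i - x) + (y j - x)) := by module
      have e2 : y i - y j = (y i - x) - (y j - x) := by abel
      rw [e1, e2, norm_smul, mul_pow, norm_add_sq_real, norm_sub_sq_real (y i - x)]
      norm_num
      ring
    rw [h2] at h1
    have := hs i
    have := hs j
    nlinarith
  have hcauchy : CauchySeq y := by
    rw [Metric.cauchySeq_iff]
    intro ε hε
    have hpos : 0 < k / 4 * ε ^ 2 := by positivity
    obtain ⟨N, hN⟩ := exists_nat_one_div_lt hpos
    refine ⟨N, fun i hi j hj => ?_⟩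
    have hi' := Nat.one_div_le_one_div (α := ℝ) hi
    have hj' := Nat.one_div_le_one_div (α := ℝ) hj
    have h1 : k / 4 * ‖y i - y j‖ ^ 2 < k / 4 * ε ^ 2 := by
      have := hdist i j
      linarith
    rw [dist_eq_norm]
    exact lt_of_pow_lt_pow_left₀ 2 hε.le (lt_of_mul_lt_mul_left h1 (by positivity))
  obtain ⟨p, hp⟩ := cauchySeq_tendsto_of_complete hcauchy
  have hle : f p ≤ ((m - k * ‖p - x‖ ^ 2 : ℝ) : EReal) := by
    by_contra! hlt
    obtain ⟨b, hb1, hb2⟩ := EReal.lt_iff_exists_real_btwn.1 hlt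
    have hb1 : m - k * ‖p - x‖ ^ 2 < b := by exact_mod_cast hb1
    have hev : ∀ᶠ n in atTop, b < s n := by
      have h1 : ∀ᶠ z in 𝓝 p, (b : EReal) < f z := hf.closed p b hb2
      filter_upwards [hp.eventually h1] with n hn
      rw [hy] at hn
      exact_mod_cast hn
    have h2 : Tendsto (fun n => b + k * ‖y n - x‖ ^ 2) atTop (𝓝 (b + k * ‖p - x‖ ^ 2)) :=
      (((hp.sub_const x).norm.pow 2).const_mul k).const_add b
    have h3 : Tendsto (fun n : ℕ => m + 1 / ((n : ℝ) + 1)) atTop (𝓝 (m + 0)) :=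
      tendsto_one_div_add_atTop_nhds_zero_nat.const_add m
    have h4 : b + k * ‖p - x‖ ^ 2 ≤ m + 0 := by
      refine le_of_tendsto_of_tendsto h2 h3 ?_
      filter_upwards [hev] with n hn
      have := hs n
      linarith
    linarith
  have hne : f p ≠ ⊤ := fun h => by rw [h, top_le_iff] at hle; exact EReal.coe_ne_top _ hle
  obtain ⟨r, hr⟩ := hf.exists_coe hne
  refine ⟨p, r, hr, fun y s hy => ?_⟩
  rw [hr] at hle
  have h1 : r ≤ m - k * ‖p - x‖ ^ 2 := by exact_mod_cast hle
  have := hm y s hy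
  linarith

theorem IsCCP.resolventOp_nonempty [CompleteSpace H] {f : H → EReal} (hf : IsCCP f) {α : ℝ}
    (hα : 0 < α) (x : H) : (resolventOp α (subdiff f) x).Nonempty := by
  obtain ⟨p, r, hr, hmin⟩ := hf.exists_prox (k := 1 / (2 * α)) (by positivity) x
  refine ⟨p, Set.mem_add.2 ⟨p, rfl, x - p, ?_, by abel⟩⟩
  refine Set.mem_smul_set.2 ⟨α⁻¹ • (x - p), fun y => ?_, by
    rw [smul_smul, mul_inv_cancel₀ hα.ne', one_smul]⟩
  by_cases htop : f y = ⊤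
  · rw [htop]; exact le_top
  obtain ⟨s, hs⟩ := hf.exists_coe htop
  rw [hr, hs]
  norm_cast
  apply le_of_forall_le_add_mul (C := 1 / (2 * α) * ‖y - p‖ ^ 2)
  intro t h0 h1
  obtain ⟨w, hw, hle⟩ := hf.convex.exists_coe_le hf hr hs h0 h1
  have h2 := hmin _ _ hw
  simp only [NNReal.coe_zero, zero_div, zero_mul, add_zero] at hle
  have e : p + t • (y - p) - x = (p - x) + t • (y - p) := by abel
  rw [e, norm_add_sq_real, norm_smul, Real.norm_of_nonneg h0.le, real_inner_smul_right,
    ← neg_sub x p, inner_neg_left] at h2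
  rw [real_inner_smul_left]
  refine le_of_mul_le_mul_left ?_ h0
  have e2 : 1 / (2 * α) * (‖-(x - p)‖ ^ 2 + 2 * (t * -⟪x - p, y - p⟫_ℝ) + (t * ‖y - p‖) ^ 2)
      = 1 / (2 * α) * ‖-(x - p)‖ ^ 2 - t * (α⁻¹ * ⟪x - p, y - p⟫_ℝ)
        + t * (t * (1 / (2 * α) * ‖y - p‖ ^ 2)) := by field_simp; ring
  rw [e2] at h2
  nlinarith

/-! ### Gradients and cocoercivity -/

/-- The subdifferential of a differentiable convex function is its gradient. -/
theorem subdiff_eq_singleton_gradient [CompleteSpace H] {f : H → EReal} (hf : IsCCP f)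
    {φ : H → ℝ} (hφ : ∀ x, f x = φ x) (hd : Differentiable ℝ φ) (x : H) :
    subdiff f x = {gradient φ x} := by
  have hderiv : ∀ d : H, Tendsto (fun t : ℝ => t⁻¹ * (φ (x + t • d) - φ x)) (𝓝[>] 0)
      (𝓝 ⟪gradient φ x, d⟫_ℝ) := by
    intro d
    have h1 : HasLineDerivAt ℝ φ ⟪gradient φ x, d⟫_ℝ x d := by
      have := (hd x).hasGradientAt.hasFDerivAt.hasLineDerivAt d
      simpa using this
    simpa using h1.tendsto_slope_zero_right
  apply Set.Subset.antisymm
  · intro u hu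
    have h1 : ∀ d : H, ⟪u, d⟫_ℝ ≤ ⟪gradient φ x, d⟫_ℝ := by
      intro d
      refine ge_of_tendsto (hderiv d) ?_
      filter_upwards [self_mem_nhdsWithin] with t ht
      have ht : 0 < t := ht
      have h := hu (x + t • d)
      rw [hφ, hφ, add_sub_cancel_left, real_inner_smul_right] at h
      have h : φ x + t * ⟪u, d⟫_ℝ ≤ φ (x + t • d) := by exact_mod_cast h
      rw [inv_mul_eq_div, le_div_iff₀ ht]
      linarith
    have h2 := h1 (u - gradient φ x)
    rw [← sub_nonpos, ← inner_sub_left, real_inner_self_nonpos, sub_eq_zero] at h2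
    exact h2
  · rintro _ rfl y
    rw [hφ, hφ]
    norm_cast
    have : ⟪gradient φ x, y - x⟫_ℝ ≤ φ y - φ x := by
      refine le_of_tendsto (hderiv (y - x)) ?_
      filter_upwards [Ioo_mem_nhdsGT (zero_lt_one (α := ℝ))] with t ht
      obtain ⟨w, hw, hle⟩ := hf.convex.exists_coe_le hf (hφ x) (hφ y) ht.1 ht.2
      rw [hφ] at hw
      have hw : φ (x + t • (y - x)) = w := by exact_mod_cast hw
      simp only [NNReal.coe_zero, zero_div, zero_mul, add_zero] at hle
      rw [hw, inv_mul_eq_div, div_le_iff₀ ht.1]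
      linarith
    linarith

/-- The descent lemma. -/
theorem le_add_inner_gradient_add_sq [CompleteSpace H] {φ : H → ℝ} {L : ℝ≥0}
    (hd : Differentiable ℝ φ) (hL : LipschitzWith L (gradient φ)) (x y : H) :
    φ y ≤ φ x + ⟪gradient φ x, y - x⟫_ℝ + L / 2 * ‖y - x‖ ^ 2 := by
  set d := y - x with hdxy
  let ψ : ℝ → ℝ := fun t => φ (x + t • d) - t * ⟪gradient φ x, d⟫_ℝ - L / 2 * t ^ 2 * ‖d‖ ^ 2
  have hψ : ∀ t : ℝ, HasDerivAt ψ
      (⟪gradient φ (x + t • d), d⟫_ℝ - ⟪gradient φ x, d⟫_ℝ - L * t * ‖d‖ ^ 2) t := by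
    intro t
    have h1 : HasDerivAt (fun t : ℝ => x + t • d) d t := by
      simpa using ((hasDerivAt_id t).smul_const d).const_add x
    have h2 : HasDerivAt (fun t : ℝ => φ (x + t • d)) ⟪gradient φ (x + t • d), d⟫_ℝ t := by
      have := (hd (x + t • d)).hasGradientAt.hasFDerivAt.comp_hasDerivAt t h1
      simpa [Function.comp_def] using this
    have h3 := ((h2.sub ((hasDerivAt_id t).mul_const ⟪gradient φ x, d⟫_ℝ)).sub
      ((((hasDerivAt_id t).pow 2).const_mul (L / 2 : ℝ)).mul_const (‖d‖ ^ 2)))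
    refine h3.congr_deriv ?_
    simp only [id_eq, Nat.cast_ofNat, Nat.add_one_sub_one, pow_one]
    ring
  have hanti : AntitoneOn ψ (Set.Icc 0 1) := by
    refine antitoneOn_of_deriv_nonpos (convex_Icc 0 1)
      (fun t _ => (hψ t).continuousAt.continuousWithinAt)
      (fun t _ => (hψ t).differentiableAt.differentiableWithinAt) ?_
    intro t ht
    rw [interior_Icc] at ht
    rw [(hψ t).deriv, ← inner_sub_left]
    have h1 := real_inner_le_norm (gradient φ (x + t • d) - gradient φ x) d
    have h2 := hL.norm_sub_le (x + t • d) x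
    rw [add_sub_cancel_left, norm_smul, Real.norm_of_nonneg ht.1.le] at h2
    have h3 : ‖gradient φ (x + t • d) - gradient φ x‖ * ‖d‖ ≤ L * (t * ‖d‖) * ‖d‖ := by gcongr
    nlinarith
  have h01 := hanti (by simp) (by simp) (zero_le_one (α := ℝ))
  simp only [ψ, one_smul, zero_smul, add_zero, zero_mul, sub_zero, one_mul, one_pow, mul_one] at h01
  have : x + d = y := by rw [hdxy]; abel
  rw [this] at h01
  linarith

/-- One half of the Baillon-Haddad inequality for strongly convex functions. -/
theorem norm_sq_gradient_sub_le [CompleteSpace H] {f : H → EReal} (hf : IsCCP f)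
    {μ L : ℝ≥0} (hμL : μ < L) (hc : IsStronglyConvex μ f) {φ : H → ℝ} (hφ : ∀ x, f x = φ x)
    (hd : Differentiable ℝ φ) (hL : LipschitzWith L (gradient φ)) (x y : H) :
    ‖gradient φ y - gradient φ x - (μ : ℝ) • (y - x)‖ ^ 2 ≤ 2 * (L - μ) *
      (φ y - φ x - ⟪gradient φ x, y - x⟫_ℝ - μ / 2 * ‖y - x‖ ^ 2) := by
  have hK : 0 < (L : ℝ) - μ := sub_pos.2 (by exact_mod_cast hμL)
  set K := (L : ℝ) - μ with hKdef
  set G := gradient φ y - gradient φ x - (μ : ℝ) • (y - x) with hG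
  -- compare the two quadratic bounds at a gradient step of `φ - μ / 2 ‖·‖²` from `y`
  set z := y - K⁻¹ • G with hz
  have h1 := hc.subgradient_le hf (x := x) (y := z) (u := gradient φ x)
    (by rw [subdiff_eq_singleton_gradient hf hφ hd]; rfl) (hφ x) (hφ z)
  have h2 := le_add_inner_gradient_add_sq hd hL y z
  have e1 : z - y = -(K⁻¹ • G) := by rw [hz]; abel
  have e2 : z - x = (y - x) - K⁻¹ • G := by rw [hz]; abel
  have e3 : gradient φ y = gradient φ x + (G + (μ : ℝ) • (y - x)) := by rw [hG]; abel
  rw [norm_sub_rev x z, e2, norm_sub_sq_real, norm_smul, inner_sub_right, real_inner_smul_right,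
    real_inner_smul_right] at h1
  rw [e1, norm_neg, norm_smul, inner_neg_right, real_inner_smul_right, e3, inner_add_left,
    inner_add_left, real_inner_smul_left, real_inner_self_eq_norm_sq] at h2
  rw [Real.norm_of_nonneg (inv_pos.2 hK).le] at h1 h2
  have hKK : K * K⁻¹ = 1 := mul_inv_cancel₀ hK.ne'
  have hLK : (L : ℝ) = K + μ := by rw [hKdef]; ring
  rw [hLK] at h2
  have h3 : K⁻¹ / 2 * ‖G‖ ^ 2 ≤ φ y - φ x - ⟪gradient φ x, y - x⟫_ℝ - μ / 2 * ‖y - x‖ ^ 2 := by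
    have e4 : (K + μ) / 2 * (K⁻¹ * ‖G‖) ^ 2
        = (K * K⁻¹) * K⁻¹ / 2 * ‖G‖ ^ 2 + μ / 2 * (K⁻¹ * ‖G‖) ^ 2 := by ring
    rw [e4, hKK] at h2
    nlinarith
  have h4 : 2 * K * (K⁻¹ / 2 * ‖G‖ ^ 2) = ‖G‖ ^ 2 := by
    linear_combination ‖G‖ ^ 2 * hKK
  rw [← h4]
  gcongr

end Convex

/-! ### Sector inequalities for subdifferentials and resolvents -/

section Resolvent

variable {H : Type*} [NormedAddCommGroup H] [InnerProductSpace ℝ H]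

theorem mem_resolventOp {α : ℝ} {A : H → Set H} {z a : H} :
    a ∈ resolventOp α A z ↔ ∃ u ∈ A a, a + α • u = z := by
  change z ∈ ({a} : Set H) + α • A a ↔ _
  simp [Set.mem_smul_set, eq_neg_add_iff_add_eq]

/-- Baillon-Haddad inequality: differences of gradients of a `μ`-strongly convex and `L`-smooth
function lie in the sector between `μ` and `L`. -/
theorem FClass.inSector_subdiff [CompleteSpace H] {f : H → EReal} {μ L : ℝ≥0}
    (hf : FClass μ (L : ℝ≥0∞) f) (hμL : μ < L) {x y u v : H} (hu : u ∈ subdiff f x)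
    (hv : v ∈ subdiff f y) : InSector (μ : ℝ) L (x - y) (u - v) := by
  obtain ⟨φ, hφ, hd, hL⟩ := hf.smooth L rfl
  rw [subdiff_eq_singleton_gradient hf.ccp hφ hd, Set.mem_singleton_iff] at hu hv
  subst hu hv
  have h1 := norm_sq_gradient_sub_le hf.ccp hμL hf.stronglyConvex hφ hd hL x y
  have h2 := norm_sq_gradient_sub_le hf.ccp hμL hf.stronglyConvex hφ hd hL y x
  set a := x - y with ha
  set w := gradient φ x - gradient φ y with hw
  have e1 : gradient φ y - gradient φ x - (μ : ℝ) • (y - x) = -(w - (μ : ℝ) • a) := by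
    rw [hw, ha]; module
  have e2 : y - x = -a := by rw [ha]; abel
  have e3 : gradient φ x = gradient φ y + w := by rw [hw]; abel
  rw [e1, norm_neg, e2, norm_neg, inner_neg_right, e3, inner_add_left] at h1
  have e4 : (L : ℝ) • a - w = ((L : ℝ) - μ) • a - (w - (μ : ℝ) • a) := by module
  unfold InSector
  rw [e4, inner_sub_right, real_inner_self_eq_norm_sq, inner_smul_right, inner_sub_left,
    real_inner_smul_left, real_inner_self_eq_norm_sq]
  nlinarith

/-- The derivative `1 / (1 + α t)` of the resolvent of a quadratic function of curvature `t`,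
with value `0` at `t = ∞`. -/
noncomputable def resolventFactor (α : ℝ) (t : ℝ≥0∞) : ℝ :=
  if t = ∞ then 0 else 1 / (1 + α * t.toReal)

theorem mul_endpointTerm {α : ℝ} (hα : 0 < α) (m : ℝ≥0) (t : ℝ≥0∞) :
    α * endpointTerm α m t
      = 2 * resolventFactor α t - (2 - α * m) * resolventFactor α t ^ 2 := by
  unfold endpointTerm resolventFactor
  split_ifs
  · simp
  · have : 0 < 1 + α * t.toReal := by positivity
    field_simp
    ring

theorem endpointTerm_nonneg {α : ℝ} (hα : 0 < α) (m : ℝ≥0) (t : ℝ≥0∞) :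
    0 ≤ endpointTerm α m t := by
  unfold endpointTerm
  split_ifs <;> positivity

theorem resolventFactor_le {α : ℝ} (hα : 0 < α) {s : ℝ≥0} {t : ℝ≥0∞} (h : (s : ℝ≥0∞) ≤ t) :
    resolventFactor α t ≤ resolventFactor α s := by
  unfold resolventFactor
  rw [if_neg ENNReal.coe_ne_top]
  split_ifs with ht
  · positivity
  · have : (s : ℝ≥0∞).toReal ≤ t.toReal := ENNReal.toReal_mono ht h
    gcongr

/-- Differences of values of the resolvent of `α ∂f` lie in the sector between the resolvent factors
of `L` and `μ`. For `L < ∞` this is the sector inequality of `∂f` rewritten in the variable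
`a + α u`; for `L = ∞` it is strong monotonicity of `∂f`. -/
theorem FClass.inSector_resolvent [CompleteSpace H] {f : H → EReal} {μ : ℝ≥0} {L : ℝ≥0∞}
    (hf : FClass μ L f) (hμL : (μ : ℝ≥0∞) < L) {α : ℝ} (hα : 0 < α) {x y a b : H}
    (ha : a ∈ resolventOp α (subdiff f) x) (hb : b ∈ resolventOp α (subdiff f) y) :
    InSector (resolventFactor α L) (resolventFactor α μ) (x - y) (a - b) := by
  obtain ⟨u, hu, rfl⟩ := mem_resolventOp.1 ha
  obtain ⟨v, hv, rfl⟩ := mem_resolventOp.1 hb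
  have e : a + α • u - (b + α • v) = (a - b) + α • (u - v) := by module
  rw [e]
  have hμ : 0 < 1 + α * (μ : ℝ) := by positivity
  unfold InSector resolventFactor
  rw [if_neg ENNReal.coe_ne_top, ENNReal.coe_toReal, inner_sector_eq]
  split_ifs with hL
  · have h := hf.stronglyConvex.inner_subgradients_ge hf.ccp hu hv
    rw [real_inner_comm, inner_add_right, real_inner_smul_right, real_inner_self_eq_norm_sq]
    rw [real_inner_comm] at h
    have h2 : 0 ≤ α * (⟪a - b, u - v⟫_ℝ - μ * ‖a - b‖ ^ 2) / (1 + α * μ) :=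
      div_nonneg (mul_nonneg hα.le (by linarith)) hμ.le
    refine h2.trans_eq ?_
    field_simp
    ring
  · lift L to ℝ≥0 using hL
    have h := hf.inSector_subdiff (by exact_mod_cast hμL) hu hv
    unfold InSector at h
    rw [inner_sector_eq] at h
    have hL' : 0 < 1 + α * (L : ℝ) := by positivity
    rw [ENNReal.coe_toReal, norm_add_sq_real, norm_smul, Real.norm_of_nonneg hα.le,
      inner_add_left, real_inner_smul_left, real_inner_smul_right, real_inner_self_eq_norm_sq,
      real_inner_comm (a - b) (u - v)]
    have h2 := div_nonneg (mul_nonneg (sq_nonneg α) h) (mul_pos hμ hL').le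
    refine h2.trans_eq ?_
    field_simp
    ring

theorem FClass.eq_of_mem_resolventOp [CompleteSpace H] {f : H → EReal} {μ : ℝ≥0} {L : ℝ≥0∞}
    (hf : FClass μ L f) (hμL : (μ : ℝ≥0∞) < L) {α : ℝ} (hα : 0 < α) {x a b : H}
    (ha : a ∈ resolventOp α (subdiff f) x) (hb : b ∈ resolventOp α (subdiff f) x) : a = b := by
  have h := hf.inSector_resolvent hμL hα ha hb
  rw [sub_self] at h
  exact sub_eq_zero.1 h.eq_zero

/-- Membership in the splitting operator. Nothing forces the three occurrences of the inner resolvent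
to pick the same value; this follows only once the resolvent is known to be single-valued. -/
theorem mem_dysOp {A B C : H → Set H} {α lam : ℝ} {x s : H} :
    s ∈ dysOp A B C α lam x ↔
      ∃ b₁ ∈ resolventOp α B x, ∃ b₂ ∈ resolventOp α B x, ∃ b₃ ∈ resolventOp α B x,
        ∃ c ∈ C b₃, ∃ a ∈ resolventOp α A ((2 : ℝ) • b₂ - x - α • c),
          x - lam • b₁ + lam • a = s := by
  have key : s ∈ dysOp A B C α lam x ↔ s ∈ ({x} : Set H) - lam • resolventOp α B x
      + lam • {a | ∃ z ∈ (2 : ℝ) • resolventOp α B x - {x}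
          - α • {c | ∃ b ∈ resolventOp α B x, c ∈ C b}, a ∈ resolventOp α A z} := Iff.rfl
  rw [key]
  simp only [Set.mem_add, Set.mem_sub, Set.mem_smul_set, Set.mem_singleton_iff, Set.mem_ofPred_eq]
  constructor
  · rintro ⟨_, ⟨_, rfl, _, ⟨b₁, h1, rfl⟩, rfl⟩, _, ⟨a, ⟨_, ⟨_, ⟨_, ⟨b₂, h2, rfl⟩, _, rfl, rfl⟩,
      _, ⟨c, ⟨b₃, h3, hc⟩, rfl⟩, rfl⟩, ha⟩, rfl⟩, rfl⟩
    exact ⟨b₁, h1, b₂, h2, b₃, h3, c, hc, a, ha, rfl⟩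
  · rintro ⟨b₁, h1, b₂, h2, b₃, h3, c, hc, a, ha, rfl⟩
    exact ⟨_, ⟨_, rfl, _, ⟨b₁, h1, rfl⟩, rfl⟩, _, ⟨a, ⟨_, ⟨_, ⟨_, ⟨b₂, h2, rfl⟩, _, rfl, rfl⟩,
      _, ⟨c, ⟨b₃, h3, hc⟩, rfl⟩, rfl⟩, ha⟩, rfl⟩, rfl⟩

theorem FClass.dysOp_nonempty [CompleteSpace H] {f g h : H → EReal} {μf μg μh Lh : ℝ≥0}
    {Lf Lg : ℝ≥0∞} (hf : FClass μf Lf f) (hg : FClass μg Lg g) (hh : FClass μh (Lh : ℝ≥0∞) h)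
    {α : ℝ} (hα : 0 < α) (lam : ℝ) (x : H) :
    (dysOp (subdiff f) (subdiff g) (subdiff h) α lam x).Nonempty := by
  obtain ⟨b, hb⟩ := hg.ccp.resolventOp_nonempty hα x
  obtain ⟨φ, hφ, hd, -⟩ := hh.smooth Lh rfl
  have hc : gradient φ b ∈ subdiff h b := by
    rw [subdiff_eq_singleton_gradient hh.ccp hφ hd]; rfl
  obtain ⟨a, ha⟩ := hf.ccp.resolventOp_nonempty hα ((2 : ℝ) • b - x - α • gradient φ b)
  exact ⟨_, mem_dysOp.2 ⟨b, hb, b, hb, b, hb, _, hc, a, ha, rfl⟩⟩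

end Resolvent

/-! ### The contraction factor -/

/-- The constant `θ - α ν` dominates the quadratic `θ - 2 u + (2 - α m) u²` at both ends of the sector
of the resolvent; this is the reason for the definition of `ν`. -/
theorem resolventFactor_quadratic_le {α : ℝ} (hα : 0 < α) (θ : ℝ) (m μ : ℝ≥0) (L : ℝ≥0∞) :
    θ - 2 * resolventFactor α L + (2 - α * m) * resolventFactor α L ^ 2 ≤ θ - α * nu α m μ L ∧
    θ - 2 * resolventFactor α μ + (2 - α * m) * resolventFactor α μ ^ 2
      ≤ θ - α * nu α m μ L := by
  have h1 : α * nu α m μ L ≤ α * endpointTerm α m μ :=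
    mul_le_mul_of_nonneg_left (min_le_left _ _) hα.le
  have h2 : α * nu α m μ L ≤ α * endpointTerm α m L :=
    mul_le_mul_of_nonneg_left (min_le_right _ _) hα.le
  rw [mul_endpointTerm hα] at h1 h2
  constructor <;> linarith

theorem nu_nonneg {α : ℝ} (hα : 0 < α) (m μ : ℝ≥0) (L : ℝ≥0∞) : 0 ≤ nu α m μ L :=
  le_min (endpointTerm_nonneg hα _ _) (endpointTerm_nonneg hα _ _)

theorem sub_mul_nu_nonneg {α θ : ℝ} (hα : 0 < α) {m M : ℝ≥0} (hmM : m ≤ M)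
    (hs : α * ((m : ℝ) + M) < 4) (hθ : θ = 2 / (4 - α * ((m : ℝ) + M))) (μ : ℝ≥0) (L : ℝ≥0∞) :
    0 ≤ θ - α * nu α m μ L := by
  refine le_trans ?_ (resolventFactor_quadratic_le hα θ m μ L).1
  set u := resolventFactor α L
  have hden : 0 < 4 - α * ((m : ℝ) + M) := by linarith
  have hθ0 : 0 < θ := by rw [hθ]; positivity
  have hθinv : θ * (2 - α * ((m : ℝ) + M) / 2) = 1 := by
    rw [hθ]; field_simp; ring
  have hδ : 0 ≤ α * ((M : ℝ) - m) / 2 := by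
    have : 0 ≤ (M : ℝ) - m := sub_nonneg.2 (by exact_mod_cast hmM)
    positivity
  -- complete the square: the quadratic is `θ (1 - u / θ)² + α (M - m) / 2 u²`
  have key : θ - 2 * u + (2 - α * m) * u ^ 2
      = θ * (1 - (2 - α * ((m : ℝ) + M) / 2) * u) ^ 2 + α * ((M : ℝ) - m) / 2 * u ^ 2 := by
    linear_combination (2 * u - (2 - α * ((m : ℝ) + M) / 2) * u ^ 2) * hθinv
  rw [key]
  positivity

end DYS

theorem theorem2 {H : Type*} [NormedAddCommGroup H] [InnerProductSpace ℝ H] [CompleteSpace H]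
    (f g h : H → EReal) (μf μg μh Lh : ℝ≥0) (Lf Lg : ℝ≥0∞)
    (hμLf : (μf : ℝ≥0∞) < Lf) (hμLg : (μg : ℝ≥0∞) < Lg) (hμLh : μh < Lh)
    (hf : DYS.FClass μf Lf f) (hg : DYS.FClass μg Lg g) (hh : DYS.FClass μh (Lh : ℝ≥0∞) h)
    (α lam : ℝ) (hα : 0 < α) (hlam : 0 < lam)
    (hlam_lt : lam < 2 - α * ((μh : ℝ) + (Lh : ℝ)) / 2)
    (νf νg θ κ : ℝ)
    (hνf : νf = DYS.nu α μh μf Lf) (hνg : νg = DYS.nu α μh μg Lg)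
    (hθ : θ = 2 / (4 - α * ((μh : ℝ) + (Lh : ℝ))))
    (hκ : κ = 1 - lam * θ + lam * Real.sqrt ((θ - α * νf) * (θ - α * νg))) :
    -- the quantities are well defined: both factors under the root are nonnegative, `0 ≤ κ ≤ 1`
    (0 ≤ θ - α * νf ∧ 0 ≤ θ - α * νg ∧ 0 ≤ κ ∧ κ ≤ 1) ∧
    -- the operator is defined everywhere
    DYS.domOp (DYS.dysOp (DYS.subdiff f) (DYS.subdiff g) (DYS.subdiff h) α lam) = Set.univ ∧
    -- it is contractive with factor `κ`
    DYS.IsContractiveOp κ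
      (DYS.dysOp (DYS.subdiff f) (DYS.subdiff g) (DYS.subdiff h) α lam) ∧
    -- and, in particular, with the factor `ρ` given by `ρ² = κ`
    (∀ ρ : ℝ, 0 ≤ ρ → ρ ^ 2 = κ →
      DYS.IsContractiveOp ρ
        (DYS.dysOp (DYS.subdiff f) (DYS.subdiff g) (DYS.subdiff h) α lam)) := by
  have hs : α * ((μh : ℝ) + Lh) < 4 := by linarith
  have hden : 0 < 4 - α * ((μh : ℝ) + Lh) := by linarith
  have hθ0 : 0 < θ := by rw [hθ]; positivity
  have hP : 0 ≤ θ - α * νf := by rw [hνf]; exact DYS.sub_mul_nu_nonneg hα hμLh.le hs hθ _ _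
  have hQ : 0 ≤ θ - α * νg := by rw [hνg]; exact DYS.sub_mul_nu_nonneg hα hμLh.le hs hθ _ _
  have hlamθ : lam * θ ≤ 1 := by
    rw [hθ, mul_div_assoc', div_le_one hden]
    linarith
  have hκ0 : 0 ≤ κ := by
    have : 0 ≤ lam * √((θ - α * νf) * (θ - α * νg)) := by positivity
    linarith
  have hsqrt : √((θ - α * νf) * (θ - α * νg)) ≤ θ := by
    rw [Real.sqrt_le_left hθ0.le, sq]
    have hf0 : 0 ≤ α * νf := mul_nonneg hα.le (hνf ▸ DYS.nu_nonneg hα _ _ _)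
    have hg0 : 0 ≤ α * νg := mul_nonneg hα.le (hνg ▸ DYS.nu_nonneg hα _ _ _)
    exact mul_le_mul (by linarith) (by linarith) hQ hθ0.le
  have hκ1 : κ ≤ 1 := by
    have := mul_le_mul_of_nonneg_left hsqrt hlam.le
    linarith
  have hcontr : DYS.IsContractiveOp κ
      (DYS.dysOp (DYS.subdiff f) (DYS.subdiff g) (DYS.subdiff h) α lam) := by
    intro x y u v hu hv
    obtain ⟨b, hb, b₂, hb₂, b₃, hb₃, c, hc, a, ha, rfl⟩ := DYS.mem_dysOp.1 hu
    obtain ⟨b', hb', b₂', hb₂', b₃', hb₃', c', hc', a', ha', rfl⟩ := DYS.mem_dysOp.1 hv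
    obtain rfl := hg.eq_of_mem_resolventOp hμLg hα hb hb₂
    obtain rfl := hg.eq_of_mem_resolventOp hμLg hα hb hb₃
    obtain rfl := hg.eq_of_mem_resolventOp hμLg hα hb' hb₂'
    obtain rfl := hg.eq_of_mem_resolventOp hμLg hα hb' hb₃'
    have sb := hg.inSector_resolvent hμLg hα hb hb'
    have sc := hh.inSector_subdiff hμLh hc hc'
    have sa := hf.inSector_resolvent hμLf hα ha ha'
    have e1 : (2 : ℝ) • b - x - α • c - ((2 : ℝ) • b' - y - α • c')
        = (2 : ℝ) • (b - b') - (x - y) - α • (c - c') := by module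
    rw [e1] at sa
    have hf2 := DYS.resolventFactor_quadratic_le hα θ μh μf Lf
    have hg2 := DYS.resolventFactor_quadratic_le hα θ μh μg Lg
    rw [← hνf] at hf2
    rw [← hνg] at hg2
    have core := DYS.norm_core_le hα (by exact_mod_cast hμLh.le) hs hθ
      (DYS.resolventFactor_le hα hμLf.le) (DYS.resolventFactor_le hα hμLg.le)
      hf2.1 hf2.2 hg2.1 hg2.2 sb sc sa
    have e2 : x - lam • b + lam • a - (y - lam • b' + lam • a')
        = (1 - lam * θ) • (x - y) + lam • (θ • (x - y) - (b - b') + (a - a')) := by module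
    rw [e2]
    refine (norm_add_le _ _).trans ?_
    rw [norm_smul, norm_smul, Real.norm_of_nonneg (sub_nonneg.2 hlamθ),
      Real.norm_of_nonneg hlam.le]
    have := mul_le_mul_of_nonneg_left core hlam.le
    rw [hκ]
    linarith
  refine ⟨⟨hP, hQ, hκ0, hκ1⟩, Set.eq_univ_of_forall fun x => hf.dysOp_nonempty hg hh hα lam x,
    hcontr, fun ρ hρ hρκ x y u v hu hv => (hcontr hu hv).trans ?_⟩
  have hρ1 : ρ ≤ 1 := by nlinarith
  have hκρ : κ ≤ ρ := by nlinarith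
  gcongr
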